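/- Let $G$ and $H$ be locally compact second countable Hausdorff abelian groups, and let $\mathcal L\subseteq G\times H$ be a discrete subgroup such that $\hat X:=(G\times H)/\mathcal L$ is compact, the projection $\pi^G:G\times H\to G$ is injective on $\mathcal L$, and the projection of $\mathcal L$ to $H$ is dense in $H$. The group $G$ acts on $\hat X$ by $\hat T_g\hat x=(g,0)+\hat x$. For a compact set $W\subseteq H$ and $\hat x=x+\mathcal L\in\hat X$ put $$\nu_W(\hat x)=\sum_{y\in(x+\mathcal L)\cap(G\times W)}\delta_y,\qquad \nu_W^G(\hat x)=\pi^G_*\nu_W(\hat x).$$ Let $\mathcal M_W$ be the vague closure of $\nu_W(\hat X)$ in the space of locally finite Borel measures on $G\times H$, and let $\mathcal M^G_W$ be the vague closure of $\nu^G_W(\hat X)$ in the space of locally finite Borel measures on $G$. The group $G$ acts on both spaces by translation of measures; these actions are denoted by $S$ (on $\mathcal M_W$ it is translation by $(g,0)$). A topological dynamical system is a compact Hausdorff space with a jointly continuous $G$-action. A factor map is a continuous equivariant surjection between such systems. A factor map $\pi:X\to Y$ is the maximal equicontinuous factor of $X$ if $Y$ is equicontinuous and every factor map from $X$ onto an equicontinuous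 system is of the form $\psi\circ\pi$ with a factor map $\psi$ on $Y$. It is an almost 1-1 extension if all points of some dense $G_\delta$ subset of $Y$ have exactly one preimage under $\pi$. **Theorem.** Let $W\subseteq H$ be compact, and assume that $\operatorname{int}(W)$ is non-empty and aperiodic, i.e. $h+\operatorname{int}(W)=\operatorname{int}(W)$ only for $h=0$. a) The systems $(\mathcal M_W,S)$ and $(\mathcal M^G_W,S)$ are topological dynamical systems, and the pushforward $\nu\mapsto\pi^G_*\nu$ is an isomorphism between them, i.e. a $G$-equivariant homeomorphism $\mathcal M_W\to\mathcal M_W^G$. There is a map $\gamma:\mathcal M_W\to\hat X$ with $\gamma(\nu_W(\hat x))=\hat x$ for all $\hat x\in\hat X$ such that, for $\Gamma:\mathcal M^G_W\to\hat X$ defined by $\Gamma\circ\pi^G_*=\gamma$, both $\gamma$ and $\Gamma$ are almost 1-1 extensions and exhibit $(\hat X,\hat T)$ as the maximal equicontinuous factor of $(\mathcal M_W,S)$ and of $(\mathcal M^G_W,S)$, respectively. b) If $M\subseteq\mathcal M^G_W$ is non-empty, closed and $S$-invariant, then $\Gamma|_M:M\to\hat X$ is an almost 1-1 extension and exhibits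 $(\hat X,\hat T)$ as the maximal equicontinuous factor of $(M,S)$. -/

import Mathlib

open Set Filter Topology MeasureTheory
open scoped CompactlySupported

universe u v w

namespace ModelSet

/-! ### Topological dynamical systems

An action of `G` on `X` is a family of maps `T : G → X → X`. -/

section Dynamics

variable {G : Type*} [AddCommGroup G] [TopologicalSpace G]
variable {X : Type*} [TopologicalSpace X] {Y : Type*} [TopologicalSpace Y]

/-- `(X, T)` is a topological dynamical system over `G`: the space `X` is compact Hausdorff and `T`
is a (jointly) continuous action of the topological group `G` on `X`. -/
structure IsSystem (T : G → X → X) : Prop where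
  compact : CompactSpace X
  t2 : T2Space X
  zero_act : ∀ x, T 0 x = x
  add_act : ∀ g h x, T (g + h) x = T g (T h x)
  continuous_act : Continuous fun p : G × X => T p.1 p.2

/-- `π` is a factor map from the system `(X, T)` onto the system `(Y, R)`. -/
structure IsFactorMap (T : G → X → X) (R : G → Y → Y) (π : X → Y) : Prop where
  source : IsSystem T
  target : IsSystem R
  continuous : Continuous π
  surjective : Function.Surjective π
  equivariant : ∀ g x, π (T g x) = R g (π x)

/-- Equicontinuity of the family `(T g)`, `g ∈ G`, at every point. It is used for systems on compact
Hausdorff spaces, where the neighbourhoods of the diagonal are the entourages of the unique uniform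
structure. -/
def IsEquicontinuous (T : G → X → X) : Prop :=
  ∀ U ∈ 𝓝ˢ (diagonal X), ∀ x : X, ∀ᶠ y in 𝓝 x, ∀ g : G, (T g x, T g y) ∈ U

/-- `(Y, R)` is, via `π`, the maximal equicontinuous factor of `(X, T)`: it is an equicontinuous
factor, and every equicontinuous factor of `(X, T)` factors through it. -/
structure IsMaximalEquicontinuousFactor (T : G → X → X) (R : G → Y → Y) (π : X → Y) : Prop where
  factor : IsFactorMap T R π
  equicontinuous : IsEquicontinuous R
  universal : ∀ (Z : Type w) [TopologicalSpace Z] (Q : G → Z → Z) (φ : X → Z),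
    IsFactorMap T Q φ → IsEquicontinuous Q → ∃ ψ : Y → Z, IsFactorMap R Q ψ ∧ ψ ∘ π = φ

/-- The factor map `π` from `(X, T)` onto `(Y, R)` makes `(X, T)` an almost 1-1 extension of
`(Y, R)`: the fibre of `π` is a singleton over all points of a dense `Gδ` set. -/
structure IsAlmostOneToOneExtension (T : G → X → X) (R : G → Y → Y) (π : X → Y) : Prop where
  factor : IsFactorMap T R π
  almost_injective : ∃ D : Set Y, IsGδ D ∧ Dense D ∧ ∀ y ∈ D, ∃! x, π x = y

/-- The action on an invariant subset. -/
def restrictAct (T : G → X → X) (M : Set X) (hM : ∀ g, MapsTo (T g) M M) : G → M → M :=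
  fun g => (hM g).restrict (T g) M M

end Dynamics

/-! ### Locally finite measures and the vague topology -/

section Measures

/-- The space of locally finite measures on (the Borel sets of) `E`. -/
def LFMeasure (E : Type*) [TopologicalSpace E] [MeasurableSpace E] : Type _ :=
  {μ : Measure E // IsLocallyFiniteMeasure μ}

/-- The vague topology: the coarsest topology for which `μ ↦ ∫ f dμ` is continuous for every
compactly supported continuous `f : E → ℝ`. -/
noncomputable instance (E : Type*) [TopologicalSpace E] [MeasurableSpace E] : TopologicalSpace (LFMeasure E) :=
  ⨅ f : C_c(E, ℝ), TopologicalSpace.induced (fun μ : LFMeasure E => ∫ x, f x ∂μ.1) inferInstance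

variable {E : Type*} [AddCommGroup E] [TopologicalSpace E] [IsTopologicalAddGroup E]
  [MeasurableSpace E] [BorelSpace E]

theorem isLocallyFinite_translate (v : E) (μ : LFMeasure E) :
    IsLocallyFiniteMeasure (μ.1.map (fun x => v + x)) := by
  have := μ.2
  refine ⟨fun x => ?_⟩
  obtain ⟨s, hs, hfin⟩ := μ.1.finiteAt_nhds (-v + x)
  have he : Measurable (fun y : E => v + y) := (continuous_const_add v).measurable
  obtain ⟨t, hts, hto, hxt⟩ := mem_nhds_iff.1 hs
  have ho : IsOpen ((fun y => -v + y) ⁻¹' t) := hto.preimage (continuous_const_add (-v))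
  refine ⟨_, ho.mem_nhds hxt, ?_⟩
  rw [Measure.map_apply he ho.measurableSet]
  refine lt_of_le_of_lt (measure_mono fun y hy => hts ?_) hfin
  simpa using hy

/-- Translation of measures: `translate v μ` is the measure `A ↦ μ (A - v)`. -/
noncomputable def translate (v : E) (μ : LFMeasure E) : LFMeasure E :=
  ⟨μ.1.map (fun x => v + x), isLocallyFinite_translate v μ⟩

theorem continuous_translate (v : E) : Continuous (translate v : LFMeasure E → LFMeasure E) := by
  refine continuous_iInf_rng.2 fun f => continuous_induced_rng.2 ?_
  let f' : C_c(E, ℝ) :=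
    { toFun := fun x => f (v + x)
      continuous_toFun := f.continuous.comp (continuous_const_add v)
      hasCompactSupport' :=
        f.hasCompactSupport.comp_homeomorph (Homeomorph.addLeft v) }
  have h : ((fun μ : LFMeasure E => ∫ x, f x ∂μ.1) ∘ translate v)
      = fun μ : LFMeasure E => ∫ x, f' x ∂μ.1 := by
    funext μ
    exact (Homeomorph.addLeft v).measurableEmbedding.integral_map (fun x => f x)
  rw [h]
  exact continuous_iInf_dom (i := f') continuous_induced_dom

end Measures

section Configurations

variable {E : Type*} [MeasurableSpace E]

/-- The configuration `∑_{y ∈ P} δ_y` of a point set `P`. -/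
noncomputable def configuration (P : Set E) : Measure E :=
  Measure.sum fun y : P => Measure.dirac (y : E)

theorem configuration_lt_top {P A : Set E} (hA : MeasurableSet A) (h : (P ∩ A).Finite) :
    configuration P A < ⊤ := by
  have h' : {y : P | (y : E) ∈ A}.Finite := by
    refine Set.Finite.of_finite_image (h.subset ?_) Subtype.val_injective.injOn
    rintro _ ⟨y, hy, rfl⟩
    exact ⟨y.2, hy⟩
  rw [configuration, Measure.sum_apply _ hA, tsum_eq_sum (s := h'.toFinset)]
  · refine ENNReal.sum_lt_top.2 fun y _ => measure_lt_top _ _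
  · intro y hy
    have : (y : E) ∉ A := by simpa using hy
    simp [Measure.dirac_apply' _ hA, this]

theorem map_configuration {f : E → E} (hf : Measurable f) {P Q : Set E} (e : P ≃ Q)
    (he : ∀ y : P, ((e y : Q) : E) = f y) :
    (configuration P).map f = configuration Q := by
  ext A hA
  rw [Measure.map_apply hf hA, configuration, configuration, Measure.sum_apply _ (hf hA),
    Measure.sum_apply _ hA, ← e.tsum_eq]
  refine tsum_congr fun y => ?_
  rw [Measure.dirac_apply' _ (hf hA), Measure.dirac_apply' _ hA, he]
  rfl

end Configurations

/-! ### Extended hulls of weak model sets -/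

section Hull

variable {G : Type u} [AddCommGroup G] [TopologicalSpace G] [IsTopologicalAddGroup G]
  [T2Space G] [LocallyCompactSpace G] [SecondCountableTopology G]
  [MeasurableSpace G] [BorelSpace G]
variable {H : Type v} [AddCommGroup H] [TopologicalSpace H] [IsTopologicalAddGroup H]
  [T2Space H] [LocallyCompactSpace H] [SecondCountableTopology H]
  [MeasurableSpace H] [BorelSpace H]

/-- The action `T̂ g x̂ = (g, 0) + x̂` of `G` on the torus `X̂ = (G × H) ⧸ L`. -/
def torusAct (L : AddSubgroup (G × H)) (g : G) (x : (G × H) ⧸ L) : (G × H) ⧸ L :=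
  (((g, 0) : G × H) : (G × H) ⧸ L) + x

/-- The point set `(x + L) ∩ (G × W)`, where `x̂ = x + L`. -/
def pointSet (L : AddSubgroup (G × H)) (W : Set H) (x : (G × H) ⧸ L) : Set (G × H) :=
  {y | (y : (G × H) ⧸ L) = x ∧ y.2 ∈ W}

theorem finite_pointSet_inter (L : AddSubgroup (G × H)) [DiscreteTopology L] (W : Set H)
    (x : (G × H) ⧸ L) {K : Set (G × H)} (hK : IsCompact K) : (pointSet L W x ∩ K).Finite := by
  obtain ⟨x, rfl⟩ := QuotientAddGroup.mk_surjective x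
  have h1 := L.tendsto_coe_cofinite_of_discrete (isDiscrete_iff_discreteTopology.2 inferInstance)
  have hK' : IsCompact ((fun y => -x + y) '' K) := hK.image (continuous_const_add (-x))
  have h2 : ((↑) ⁻¹' ((fun y => -x + y) '' K) : Set L).Finite := by
    have := h1 hK'.compl_mem_cocompact
    simpa [Filter.mem_map, mem_cofinite, ← preimage_compl] using this
  refine (h2.image fun l : L => x + (l : G × H)).subset ?_
  rintro y ⟨⟨hy, -⟩, hyK⟩
  have hm : -x + y ∈ L := QuotientAddGroup.eq.1 hy.symm
  exact ⟨⟨-x + y, hm⟩, ⟨y, hyK, rfl⟩, by simp⟩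

/-- The map `ν_W : X̂ → 𝓜(G × H)`, `ν_W(x + L) = ∑_{y ∈ (x + L) ∩ (G × W)} δ_y`. -/
noncomputable def nuW (L : AddSubgroup (G × H)) [DiscreteTopology L]
    (W : TopologicalSpace.Compacts H) (x : (G × H) ⧸ L) : LFMeasure (G × H) :=
  ⟨configuration (pointSet L W x), ⟨fun y => by
    obtain ⟨K, hK, hy⟩ := exists_compact_mem_nhds y
    exact ⟨K, hy, configuration_lt_top hK.measurableSet (finite_pointSet_inter L W x hK)⟩⟩⟩

/-- The map `ν_W^G : X̂ → 𝓜(G)`, the pushforward of `ν_W` under the projection `G × H → G`. -/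
noncomputable def nuWG (L : AddSubgroup (G × H)) [DiscreteTopology L]
    (W : TopologicalSpace.Compacts H) (x : (G × H) ⧸ L) : LFMeasure G :=
  ⟨(nuW L W x).1.map Prod.fst, ⟨fun y => by
    obtain ⟨K, hK, hy⟩ := exists_compact_mem_nhds y
    refine ⟨K, hy, ?_⟩
    rw [Measure.map_apply measurable_fst hK.measurableSet]
    refine configuration_lt_top (measurable_fst hK.measurableSet) ?_
    refine (finite_pointSet_inter L W x (hK.prod W.isCompact)).subset ?_
    rintro z ⟨hz, hzK⟩
    exact ⟨hz, hzK, hz.2⟩⟩⟩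

/-- The extended hull `𝓜_W`: the vague closure of `ν_W(X̂)` in `𝓜(G × H)`. -/
def MW (L : AddSubgroup (G × H)) [DiscreteTopology L] (W : TopologicalSpace.Compacts H) :
    Set (LFMeasure (G × H)) :=
  closure (range (nuW L W))

/-- The extended hull `𝓜_W^G`: the vague closure of `ν_W^G(X̂)` in `𝓜(G)`. -/
def MWG (L : AddSubgroup (G × H)) [DiscreteTopology L] (W : TopologicalSpace.Compacts H) :
    Set (LFMeasure G) :=
  closure (range (nuWG L W))

theorem translate_nuW (L : AddSubgroup (G × H)) [DiscreteTopology L]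
    (W : TopologicalSpace.Compacts H) (g : G) (x : (G × H) ⧸ L) :
    translate ((g, 0) : G × H) (nuW L W x) = nuW L W (torusAct L g x) := by
  refine Subtype.ext ?_
  refine map_configuration (continuous_const_add _).measurable
    ((Equiv.addLeft ((g, 0) : G × H)).subtypeEquiv fun y => ?_) fun y => rfl
  simp [pointSet, torusAct, QuotientAddGroup.mk_add]

theorem translate_nuWG (L : AddSubgroup (G × H)) [DiscreteTopology L]
    (W : TopologicalSpace.Compacts H) (g : G) (x : (G × H) ⧸ L) :
    translate g (nuWG L W x) = nuWG L W (torusAct L g x) := by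
  refine Subtype.ext ?_
  have h := congrArg (fun μ : LFMeasure (G × H) => μ.1.map Prod.fst) (translate_nuW L W g x)
  refine Eq.trans ?_ h
  change ((nuW L W x).1.map Prod.fst).map _ = ((nuW L W x).1.map _).map Prod.fst
  rw [Measure.map_map (continuous_const_add g).measurable measurable_fst,
    Measure.map_map measurable_fst (continuous_const_add _).measurable]
  rfl

theorem mapsTo_MW (L : AddSubgroup (G × H)) [DiscreteTopology L]
    (W : TopologicalSpace.Compacts H) (g : G) :
    MapsTo (translate ((g, 0) : G × H)) (MW L W) (MW L W) := by
  refine MapsTo.closure ?_ (continuous_translate _)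
  rintro _ ⟨x, rfl⟩
  exact ⟨_, (translate_nuW L W g x).symm⟩

theorem mapsTo_MWG (L : AddSubgroup (G × H)) [DiscreteTopology L]
    (W : TopologicalSpace.Compacts H) (g : G) :
    MapsTo (translate g) (MWG L W) (MWG L W) := by
  refine MapsTo.closure ?_ (continuous_translate _)
  rintro _ ⟨x, rfl⟩
  exact ⟨_, (translate_nuWG L W g x).symm⟩

/-- The translation action `S` of `G` on `𝓜_W`. -/
noncomputable def actMW (L : AddSubgroup (G × H)) [DiscreteTopology L]
    (W : TopologicalSpace.Compacts H) : G → MW L W → MW L W :=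
  restrictAct (fun g => translate ((g, 0) : G × H)) (MW L W) (mapsTo_MW L W)

/-- The translation action `S` of `G` on `𝓜_W^G`. -/
noncomputable def actMWG (L : AddSubgroup (G × H)) [DiscreteTopology L]
    (W : TopologicalSpace.Compacts H) : G → MWG L W → MWG L W :=
  restrictAct (fun g => translate g) (MWG L W) (mapsTo_MWG L W)

/-- A subset `A` of `H` is aperiodic if `h + A = A` implies `h = 0`. -/
def IsAperiodic (A : Set H) : Prop :=
  ∀ h : H, (fun a => h + a) '' A = A → h = 0

end Hull

end ModelSet

open ModelSet

/-!
Write `t + A`, with `t : G × H` and `A ⊆ L`, for a subset of the coset `t + L`. The configuration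
`∑ δ_y`, `y ∈ t + A`, depends continuously on `(t, A) ∈ (G × H) × {0, 1}^L`, because only finitely
many lattice points contribute to the integral of a compactly supported function
(`continuous_patch`). The parameters of the configurations `ν_W(t + L)` satisfy the closed condition
that `A` contains all `ℓ` with `(t + ℓ)_H ∈ int W` and only `ℓ` with `(t + ℓ)_H ∈ W`
(`admissible`), and `t` may be restricted to a compact set that meets every coset. Hence `𝓜_W` is
the image of a compact set of admissible parameters (`exists_isCompact_image_patch_eq_MW`), and
it is compact. Continuity of the action and of maps defined on `𝓜_W` can be checked on parameters.

As `int W` is non-empty and `L` projects densely to `H`, a configuration of the hull is not zero, so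
it determines the coset that contains its points. This is the factor map `γ` (`cosetMap`). Over a
coset without points above the boundary of `W`, admissibility leaves only one choice for `A`; by
Baire's theorem these cosets form a dense `Gδ` set (`isAlmostOneToOneExtension_cosetMap`).

Configurations of the hull live over the compact window, so the pushforward to `G` is continuous on
`𝓜_W`. It is injective: if two configurations have the same projection to `G`, then by injectivity
of the projection on `L` they are given by the same lattice points up to a shift, and density of
the projection to `H` shows that the remaining shift in `H` is a period of `int W`
(`patchSet_eq_of_image_fst_eq`).

The maximality of the torus is abstract. The torus is minimal and equicontinuous, and two points in
the same fibre of an almost 1-1 extension of a minimal system are proximal, hence identified by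
every equicontinuous factor (`IsAlmostOneToOneExtension.eq_of_equicontinuous`). Moreover almost 1-1
extensions of minimal systems restrict to such extensions on every subsystem.
-/

set_option linter.unusedSectionVars false

namespace ModelSet

/-! ### Almost 1-1 extensions of minimal equicontinuous systems -/

section AlmostOneToOne

variable {G : Type*} [AddCommGroup G] [TopologicalSpace G]
variable {X : Type*} [TopologicalSpace X] {Y : Type*} [TopologicalSpace Y]

/-- The action `T` is minimal: every orbit is dense. -/
def IsMinimalAct (T : G → X → X) : Prop :=
  ∀ x, Dense (range fun g => T g x)

theorem IsSystem.restrictAct {T : G → X → X} (h : IsSystem T) {M : Set X}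
    (hM : ∀ g, MapsTo (T g) M M) (hc : IsClosed M) : IsSystem (restrictAct T M hM) where
  compact := by
    have := h.compact
    exact isCompact_iff_compactSpace.1 hc.isCompact
  t2 := by
    have := h.t2
    infer_instance
  zero_act x := Subtype.ext (h.zero_act x.1)
  add_act g g' x := Subtype.ext (h.add_act g g' x.1)
  continuous_act := by
    refine Continuous.subtype_mk ?_ fun p : G × M => hM p.1 p.2.2
    exact h.continuous_act.comp (continuous_id.prodMap continuous_subtype_val)

theorem IsSystem.of_homeomorph {T : G → X → X} {R : G → Y → Y} (h : IsSystem T) (e : X ≃ₜ Y)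
    (he : ∀ g x, e (T g x) = R g (e x)) : IsSystem R := by
  have hR : ∀ g y, R g y = e (T g (e.symm y)) := fun g y => by rw [he, e.apply_symm_apply]
  have := h.compact
  have := h.t2
  refine ⟨e.compactSpace, e.t2Space, fun y => ?_, fun g g' y => ?_, ?_⟩
  · rw [hR, h.zero_act, e.apply_symm_apply]
  · rw [hR, hR g, hR g', h.add_act, e.symm_apply_apply]
  · simp only [hR]
    exact e.continuous.comp (h.continuous_act.comp (continuous_id.prodMap e.symm.continuous))

theorem IsAlmostOneToOneExtension.of_homeomorph {Z : Type*} [TopologicalSpace Z]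
    {T : G → X → X} {T' : G → Z → Z} {R : G → Y → Y} {π : X → Y}
    (h : IsAlmostOneToOneExtension T R π) (e : X ≃ₜ Z) (he : ∀ g x, e (T g x) = T' g (e x)) :
    IsAlmostOneToOneExtension T' R (π ∘ e.symm) where
  factor :=
    { source := h.factor.source.of_homeomorph e he
      target := h.factor.target
      continuous := h.factor.continuous.comp e.symm.continuous
      surjective := h.factor.surjective.comp e.symm.surjective
      equivariant := fun g z => by
        have : e.symm (T' g z) = T g (e.symm z) := by
          rw [e.symm_apply_eq, he, e.apply_symm_apply]
        simp only [Function.comp_apply, this, h.factor.equivariant] }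
  almost_injective := by
    obtain ⟨D, hD, hd, hu⟩ := h.almost_injective
    refine ⟨D, hD, hd, fun y hy => ?_⟩
    obtain ⟨x, hx, hxu⟩ := hu y hy
    refine ⟨e x, by simpa using hx, fun z hz => ?_⟩
    rw [← e.symm_apply_eq]
    exact hxu _ hz

/-- Almost 1-1 extensions of minimal systems restrict to almost 1-1 extensions of the same system
on every subsystem: the image of the subsystem is closed and invariant, hence everything. -/
theorem IsAlmostOneToOneExtension.restrictAct {T : G → X → X} {R : G → Y → Y} {π : X → Y}
    (h : IsAlmostOneToOneExtension T R π) (hR : IsMinimalAct R) {M : Set X}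
    (hM : ∀ g, MapsTo (T g) M M) (hne : M.Nonempty) (hc : IsClosed M) :
    IsAlmostOneToOneExtension (restrictAct T M hM) R (fun x : M => π x.1) := by
  have := h.factor.source.compact
  have := h.factor.target.t2
  have hsurj : Function.Surjective (fun x : M => π x.1) := by
    obtain ⟨x, hx⟩ := hne
    have hcl : IsClosed (π '' M) := (hc.isCompact.image h.factor.continuous).isClosed
    have hsub : range (fun g => R g (π x)) ⊆ π '' M := by
      rintro _ ⟨g, rfl⟩
      exact ⟨T g x, hM g hx, h.factor.equivariant g x⟩
    intro y
    obtain ⟨x', hx', rfl⟩ := hcl.closure_subset_iff.2 hsub (hR (π x) y)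
    exact ⟨⟨x', hx'⟩, rfl⟩
  refine ⟨⟨h.factor.source.restrictAct hM hc, h.factor.target,
    h.factor.continuous.comp continuous_subtype_val, hsurj,
    fun g x => h.factor.equivariant g x.1⟩, ?_⟩
  obtain ⟨D, hD, hd, hu⟩ := h.almost_injective
  refine ⟨D, hD, hd, fun y hy => ?_⟩
  obtain ⟨x, hx⟩ := hsurj y
  exact ⟨x, hx, fun x' hx' => Subtype.ext ((hu y hy).unique hx' hx)⟩

/-- Equicontinuous factors of `(X, T)` identify points in the same fibre of an almost 1-1 extension
`π` of a minimal system. Such points are proximal: moving their common image close to a point with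
a singleton fibre moves both of them close to the point of that fibre. -/
theorem IsAlmostOneToOneExtension.eq_of_equicontinuous {T : G → X → X} {R : G → Y → Y}
    {π : X → Y} (h : IsAlmostOneToOneExtension T R π) (hR : IsMinimalAct R)
    {Z : Type*} [TopologicalSpace Z] {Q : G → Z → Z} {φ : X → Z} (hφ : IsFactorMap T Q φ)
    (hQ : IsEquicontinuous Q) {a b : X} (hab : π a = π b) : φ a = φ b := by
  have := h.factor.source.compact
  have := h.factor.target.t2
  have := hφ.target.t2
  by_contra hne
  obtain ⟨O, O', hO, hO', haO, hbO', hdisj⟩ := t2_separation hne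
  -- if `(c, φ a)` and `(c, φ b)` lie in `V`, then `c` lies in both `O` and `O'`
  let V : Set (Z × Z) := (Oᶜ ×ˢ {φ a} ∪ O'ᶜ ×ˢ {φ b})ᶜ
  have hV : V ∈ 𝓝ˢ (diagonal Z) := by
    refine IsOpen.mem_nhdsSet ?_ |>.2 ?_
    · exact ((hO.isClosed_compl.prod isClosed_singleton).union
        (hO'.isClosed_compl.prod isClosed_singleton)).isOpen_compl
    · rintro ⟨z, z'⟩ (rfl : z = z')
      rintro (⟨h1, h2⟩ | ⟨h1, h2⟩)
      · exact h1 ((mem_singleton_iff.1 h2 : z = φ a) ▸ haO)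
      · exact h1 ((mem_singleton_iff.1 h2 : z = φ b) ▸ hbO')
  obtain ⟨D, -, hd, hu⟩ := h.almost_injective
  obtain ⟨y, hy⟩ := hd.nonempty_iff.2 ⟨π a⟩
  obtain ⟨x, hx, hxu⟩ := hu y hy
  have hN : ∀ᶠ x' in 𝓝 x, ∀ g, (Q g (φ x), Q g (φ x')) ∈ V :=
    hφ.continuous.continuousAt.eventually (hQ V hV (φ x))
  have hB : ∀ᶠ y' in 𝓝 y, ∀ x', π x' = y' → ∀ g, (Q g (φ x), Q g (φ x')) ∈ V := by
    have hcm : IsClosedMap π := h.factor.continuous.isClosedMap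
    have h1 := hcm.eventually_nhds_fiber (p := fun x' => ∀ g, (Q g (φ x), Q g (φ x')) ∈ V) (y₀ := y)
      (fun x' hx' => by
        rw [hxu x' hx']
        exact hN)
    exact h1
  obtain ⟨_, ⟨g, rfl⟩, hg⟩ := (hR (π a)).exists_mem_open isOpen_interior
    ⟨y, mem_interior_iff_mem_nhds.2 hB⟩
  have hg' := interior_subset hg
  have key : ∀ c, π c = π a → (Q (-g) (φ x), φ c) ∈ V := by
    intro c hc
    have := hg' (T g c) (by rw [h.factor.equivariant, hc]) (-g)
    rwa [← hφ.equivariant (-g) (T g c), ← h.factor.source.add_act, neg_add_cancel,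
      h.factor.source.zero_act] at this
  have h1 : Q (-g) (φ x) ∈ O := by
    by_contra hcon
    exact key a rfl (Or.inl ⟨hcon, rfl⟩)
  have h2 : Q (-g) (φ x) ∈ O' := by
    by_contra hcon
    exact key b hab.symm (Or.inr ⟨hcon, rfl⟩)
  exact disjoint_left.1 hdisj h1 h2

/-- An equicontinuous minimal system is the maximal equicontinuous factor of each of its almost
1-1 extensions. -/
theorem IsAlmostOneToOneExtension.isMaximalEquicontinuousFactor {T : G → X → X} {R : G → Y → Y}
    {π : X → Y} (h : IsAlmostOneToOneExtension T R π) (hR : IsMinimalAct R)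
    (hRe : IsEquicontinuous R) : IsMaximalEquicontinuousFactor.{w} T R π := by
  refine ⟨h.factor, hRe, fun Z _ Q φ hφ hQ => ?_⟩
  have := h.factor.source.compact
  have := h.factor.target.t2
  have hq : IsQuotientMap π :=
    h.factor.continuous.isClosedMap.isQuotientMap h.factor.continuous h.factor.surjective
  let s : Y → X := Function.surjInv h.factor.surjective
  have hs : ∀ y, π (s y) = y := Function.surjInv_eq h.factor.surjective
  have hψ : (φ ∘ s) ∘ π = φ :=
    funext fun x => h.eq_of_equicontinuous hR hφ hQ (hs (π x))
  refine ⟨φ ∘ s, ⟨h.factor.target, hφ.target, ?_, ?_, fun g y => ?_⟩, hψ⟩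
  · rw [hq.continuous_iff, hψ]
    exact hφ.continuous
  · refine Function.Surjective.of_comp (g := π) ?_
    rw [hψ]
    exact hφ.surjective
  · have h1 := congrFun hψ (T g (s y))
    rw [hφ.equivariant, Function.comp_apply, h.factor.equivariant, hs] at h1
    exact h1

end AlmostOneToOne

/-! ### The vague topology -/

section Vague

variable {E : Type*} [TopologicalSpace E] [MeasurableSpace E]

theorem continuous_vague_iff {X : Type*} [TopologicalSpace X] {F : X → LFMeasure E} :
    Continuous F ↔ ∀ f : C_c(E, ℝ), Continuous fun x => ∫ y, f y ∂(F x).1 := by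
  rw [continuous_iInf_rng]
  exact forall_congr' fun f => continuous_induced_rng

theorem continuous_integral_vague (f : C_c(E, ℝ)) :
    Continuous fun μ : LFMeasure E => ∫ x, f x ∂μ.1 :=
  continuous_vague_iff.1 continuous_id f

instance t2Space_vague [T2Space E] [LocallyCompactSpace E] [SecondCountableTopology E]
    [BorelSpace E] : T2Space (LFMeasure E) := by
  refine ⟨fun μ ν hne => ?_⟩
  have := μ.2
  have := ν.2
  obtain ⟨f, hf⟩ : ∃ f : C_c(E, ℝ), ∫ x, f x ∂μ.1 ≠ ∫ x, f x ∂ν.1 := by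
    by_contra! hcon
    exact hne (Subtype.ext (Measure.ext_of_integral_eq_on_compactlySupported hcon))
  exact separated_by_continuous (continuous_integral_vague f) hf

end Vague

/-! ### Configurations -/

section Configurations

variable {E : Type*} [MeasurableSpace E]

theorem configuration_eq_zero_iff {P A : Set E} (hA : MeasurableSet A) :
    configuration P A = 0 ↔ Disjoint P A := by
  rw [configuration, Measure.sum_apply _ hA, ENNReal.tsum_eq_zero, disjoint_left]
  simp only [Measure.dirac_apply' _ hA, indicator_apply_eq_zero, Pi.one_apply, one_ne_zero,
    imp_false, Subtype.forall]

theorem configuration_injective [MeasurableSingletonClass E] :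
    Function.Injective (configuration (E := E)) := by
  have key : ∀ (P : Set E) (y : E), y ∈ P ↔ configuration P {y} ≠ 0 := fun P y => by
    rw [Ne, configuration_eq_zero_iff (measurableSet_singleton y), disjoint_singleton_right,
      not_not]
  intro P Q h
  ext y
  rw [key, key, h]

theorem integral_configuration [MeasurableSingletonClass E] {P : Set E} {f : E → ℝ}
    (hf : Integrable f (configuration P)) :
    ∫ x, f x ∂configuration P = ∑' y : P, f y := by
  rw [configuration, integral_sum_measure hf]
  simp only [integral_dirac]

end Configurations

/-! ### Configurations supported in a coset of the lattice -/

section Patches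

variable {G : Type u} [AddCommGroup G] [TopologicalSpace G] [IsTopologicalAddGroup G]
  [T2Space G] [LocallyCompactSpace G] [SecondCountableTopology G]
  [MeasurableSpace G] [BorelSpace G]
variable {H : Type v} [AddCommGroup H] [TopologicalSpace H] [IsTopologicalAddGroup H]
  [T2Space H] [LocallyCompactSpace H] [SecondCountableTopology H]
  [MeasurableSpace H] [BorelSpace H]
variable (L : AddSubgroup (G × H))

/-- The subset `{t + ℓ | A ℓ}` of the coset `t + L`. The set of lattice points is encoded by a map
to `Bool`, so that the sets of lattice points form a compact Hausdorff space. -/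
def patchSet (p : (G × H) × (L → Bool)) : Set (G × H) :=
  (fun ℓ : L => p.1 + (ℓ : G × H)) '' {ℓ | p.2 ℓ = true}

variable {L}

theorem add_mem_patchSet {p : (G × H) × (L → Bool)} {ℓ : L} :
    p.1 + (ℓ : G × H) ∈ patchSet L p ↔ p.2 ℓ = true := by
  refine ⟨?_, fun h => ⟨ℓ, h, rfl⟩⟩
  rintro ⟨ℓ', h, he⟩
  rwa [← Subtype.ext (add_left_cancel he)]

theorem mk_eq_of_mem_patchSet {p : (G × H) × (L → Bool)} {y : G × H} (hy : y ∈ patchSet L p) :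
    (y : (G × H) ⧸ L) = p.1 := by
  obtain ⟨ℓ, -, rfl⟩ := hy
  exact QuotientAddGroup.mk_add_of_mem _ ℓ.2

variable [DiscreteTopology L]

theorem finite_patchSet_inter (p : (G × H) × (L → Bool)) {K : Set (G × H)} (hK : IsCompact K) :
    (patchSet L p ∩ K).Finite := by
  refine (finite_pointSet_inter L univ (p.1 : (G × H) ⧸ L) hK).subset ?_
  rintro y ⟨hy, hyK⟩
  exact ⟨⟨mk_eq_of_mem_patchSet hy, mem_univ _⟩, hyK⟩

variable (L) in
/-- The configuration `∑ δ_{t + ℓ}`, where `ℓ` runs through the lattice points selected by `A`. -/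
noncomputable def patch (p : (G × H) × (L → Bool)) : LFMeasure (G × H) :=
  ⟨configuration (patchSet L p), ⟨fun y => by
    obtain ⟨K, hK, hy⟩ := exists_compact_mem_nhds y
    exact ⟨K, hy, configuration_lt_top hK.measurableSet (finite_patchSet_inter p hK)⟩⟩⟩

theorem integral_patch (p : (G × H) × (L → Bool)) (f : C_c(G × H, ℝ)) :
    ∫ x, f x ∂(patch L p).1 = ∑ᶠ ℓ : L, if p.2 ℓ = true then f (p.1 + (ℓ : G × H)) else 0 := by
  classical
  have : IsLocallyFiniteMeasure (configuration (patchSet L p)) := (patch L p).2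
  have hinj : Function.Injective fun ℓ : L => p.1 + (ℓ : G × H) :=
    fun a b h => Subtype.ext (add_left_cancel h)
  have hind : ({ℓ : L | p.2 ℓ = true}.indicator fun ℓ => f (p.1 + (ℓ : G × H)))
      = fun ℓ => if p.2 ℓ = true then f (p.1 + (ℓ : G × H)) else 0 := by
    ext ℓ
    simp [indicator_apply]
  have hfin : (Function.support
      fun ℓ : L => if p.2 ℓ = true then f (p.1 + (ℓ : G × H)) else 0).Finite := by
    refine Set.Finite.of_finite_image (f := fun ℓ : L => p.1 + (ℓ : G × H))
      ((finite_patchSet_inter p f.hasCompactSupport).subset ?_) hinj.injOn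
    rintro _ ⟨ℓ, hℓ, rfl⟩
    have hℓ' : p.2 ℓ = true ∧ f (p.1 + (ℓ : G × H)) ≠ 0 := by simpa using hℓ
    exact ⟨⟨ℓ, hℓ'.1, rfl⟩, subset_tsupport f hℓ'.2⟩
  have h1 := integral_configuration (P := patchSet L p) (f := f) f.integrable (E := G × H)
  refine h1.trans ?_
  rw [patchSet, tsum_image f hinj.injOn, tsum_subtype {ℓ : L | p.2 ℓ = true}
    (fun ℓ => f (p.1 + (ℓ : G × H))), hind, tsum_eq_finsum hfin]

/-- Patches depend continuously on their parameters: near a given `t`, only finitely many lattice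
points contribute to the integral of a compactly supported function. -/
theorem continuous_patch : Continuous (patch L) := by
  refine continuous_vague_iff.2 fun f => ?_
  simp only [integral_patch]
  refine continuous_finsum (fun ℓ => ?_) fun p => ?_
  · have h1 : Continuous fun q : ((G × H) × (L → Bool)) × Bool =>
        if q.2 = true then f (q.1.1 + (ℓ : G × H)) else 0 := by
      refine Continuous.if (fun q hq => ?_) ?_ continuous_const
      · have : IsClopen {q : ((G × H) × (L → Bool)) × Bool | q.2 = true} :=
          (isClopen_discrete {true}).preimage continuous_snd
        rw [this.frontier_eq] at hq
        exact hq.elim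
      · exact f.continuous.comp (continuous_fst.fst.add continuous_const)
    exact h1.comp (continuous_id.prodMk ((continuous_apply ℓ).comp continuous_snd))
  · obtain ⟨C, hC, hCp⟩ := exists_compact_mem_nhds p.1
    refine ⟨Prod.fst ⁻¹' C, continuous_fst.continuousAt hCp, ?_⟩
    have hK : IsCompact ((fun q : (G × H) × (G × H) => q.1 - q.2) '' (tsupport f ×ˢ C)) :=
      (f.hasCompactSupport.prod hC).image continuous_sub
    have h2 := L.tendsto_coe_cofinite_of_discrete (isDiscrete_iff_discreteTopology.2 inferInstance)
    have h3 : ((↑) ⁻¹' ((fun q : (G × H) × (G × H) => q.1 - q.2) '' (tsupport f ×ˢ C)) :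
        Set L).Finite := by
      have := h2 hK.compl_mem_cocompact
      simpa [Filter.mem_map, mem_cofinite, ← preimage_compl] using this
    refine h3.subset ?_
    rintro ℓ ⟨q, hq, hqC⟩
    have hq' : q.2 ℓ = true ∧ f (q.1 + (ℓ : G × H)) ≠ 0 := by simpa using hq
    exact ⟨(q.1 + ℓ, q.1), ⟨subset_tsupport f hq'.2, hqC⟩, by simp⟩

theorem translate_patch (v : G × H) (p : (G × H) × (L → Bool)) :
    translate v (patch L p) = patch L (v + p.1, p.2) := by
  refine Subtype.ext (map_configuration (continuous_const_add _).measurable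
    ((Equiv.addLeft v).subtypeEquiv fun y => ?_) fun y => rfl)
  constructor
  · rintro ⟨ℓ, hℓ, rfl⟩
    exact ⟨ℓ, hℓ, add_assoc _ _ _⟩
  · rintro ⟨ℓ, hℓ, he⟩
    refine ⟨ℓ, hℓ, add_left_cancel (a := v) ?_⟩
    rw [← add_assoc]
    exact he

/-! ### Parametrization of the extended hull -/

variable (L) in
/-- The lattice points that the window `W` selects in the coset `t + L`, with their base point. -/
noncomputable def windowParam (W : Set H) (t : G × H) : (G × H) × (L → Bool) :=
  open scoped Classical in (t, fun ℓ => decide ((t + (ℓ : G × H)).2 ∈ W))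

theorem patchSet_windowParam (W : Set H) (t : G × H) :
    patchSet L (windowParam L W t) = pointSet L W (t : (G × H) ⧸ L) := by
  ext y
  constructor
  · rintro ⟨ℓ, hℓ, rfl⟩
    exact ⟨QuotientAddGroup.mk_add_of_mem _ ℓ.2, by simpa [windowParam] using hℓ⟩
  · rintro ⟨hy, hyW⟩
    exact ⟨⟨-t + y, QuotientAddGroup.eq.1 hy.symm⟩, by simpa [windowParam] using hyW,
      by simp [windowParam]⟩

theorem patch_windowParam (W : TopologicalSpace.Compacts H) (t : G × H) :
    patch L (windowParam L W t) = nuW L W (t : (G × H) ⧸ L) :=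
  Subtype.ext (congrArg configuration (patchSet_windowParam (W : Set H) t))

variable (L) in
/-- The pairs `(t, A)` such that `t + A` contains all points of `t + L` over the interior of `W`
and only points over `W`. -/
def admissible (W : Set H) : Set ((G × H) × (L → Bool)) :=
  {p | ∀ ℓ : L, ((p.1 + (ℓ : G × H)).2 ∈ interior W → p.2 ℓ = true) ∧
    (p.2 ℓ = true → (p.1 + (ℓ : G × H)).2 ∈ W)}

theorem windowParam_mem_admissible (W : Set H) (t : G × H) :
    windowParam L W t ∈ admissible L W := by
  intro ℓ
  simp only [windowParam, decide_eq_true_eq]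
  exact ⟨fun h => interior_subset h, id⟩

theorem isClosed_admissible {W : Set H} (hW : IsClosed W) : IsClosed (admissible L W) := by
  simp only [admissible, ofPred_forall, ofPred_and]
  refine isClosed_iInter fun ℓ => ?_
  have h1 : Continuous fun p : (G × H) × (L → Bool) => (p.1 + (ℓ : G × H)).2 := by fun_prop
  have h2 : IsClopen {p : (G × H) × (L → Bool) | p.2 ℓ = true} :=
    (isClopen_discrete {true}).preimage ((continuous_apply ℓ).comp continuous_snd)
  exact (isClosed_imp (isOpen_interior.preimage h1) h2.isClosed).inter
    (isClosed_imp h2.isOpen (hW.preimage h1))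

end Patches

section Torus

variable {G : Type u} [AddCommGroup G] [TopologicalSpace G] [IsTopologicalAddGroup G]
  [T2Space G] [LocallyCompactSpace G] [SecondCountableTopology G]
  [MeasurableSpace G] [BorelSpace G]
variable {H : Type v} [AddCommGroup H] [TopologicalSpace H] [IsTopologicalAddGroup H]
  [T2Space H] [LocallyCompactSpace H] [SecondCountableTopology H]
  [MeasurableSpace H] [BorelSpace H]
variable (L : AddSubgroup (G × H))

/-! ### The torus -/

theorem isSystem_torusAct [DiscreteTopology L] [CompactSpace ((G × H) ⧸ L)] :
    IsSystem (torusAct L) where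
  compact := inferInstance
  t2 := by
    have : IsClosed (L : Set (G × H)) := AddSubgroup.isClosed_of_discrete
    infer_instance
  zero_act x := zero_add x
  add_act g g' x := by
    have : ((g + g', 0) : G × H) = (g, 0) + (g', 0) := by simp
    simp only [torusAct, this, QuotientAddGroup.mk_add, add_assoc]
  continuous_act := by
    have : Continuous fun p : G × ((G × H) ⧸ L) =>
        (((p.1, 0) : G × H) : (G × H) ⧸ L) :=
      QuotientAddGroup.continuous_mk.comp (continuous_fst.prodMk continuous_const)
    exact this.add continuous_snd

theorem isMinimalAct_torusAct (hL : Dense (Prod.snd '' (L : Set (G × H)))) :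
    IsMinimalAct (torusAct L) := by
  intro x
  obtain ⟨t, rfl⟩ := QuotientAddGroup.mk_surjective x
  rw [dense_iff_inter_open]
  rintro U hU ⟨y, hy⟩
  obtain ⟨s, rfl⟩ := QuotientAddGroup.mk_surjective y
  obtain ⟨A, B, hA, hB, hsA, hsB, hAB⟩ :=
    isOpen_prod_iff.1 (hU.preimage QuotientAddGroup.continuous_mk) s.1 s.2 hy
  obtain ⟨_, ⟨ℓ, hℓ, rfl⟩, hℓB⟩ := hL.exists_mem_open (hB.preimage (continuous_const_add t.2))
    ⟨-t.2 + s.2, by simpa using hsB⟩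
  refine ⟨_, ?_, ⟨s.1 - (t.1 + ℓ.1), rfl⟩⟩
  have h1 : ((s.1 - (t.1 + ℓ.1), 0) : G × H) + (t + ℓ) ∈ A ×ˢ B :=
    ⟨by simpa using hsA, by simpa using hℓB⟩
  have h2 := hAB h1
  rwa [mem_preimage, QuotientAddGroup.mk_add, QuotientAddGroup.mk_add_of_mem _ hℓ] at h2

theorem isEquicontinuous_torusAct [CompactSpace ((G × H) ⧸ L)] :
    IsEquicontinuous (torusAct L) := by
  intro U hU x
  rw [mem_nhdsSet_iff_forall] at hU
  have h1 : ∀ᶠ d in 𝓝 (0 : (G × H) ⧸ L), ∀ y ∈ (univ : Set ((G × H) ⧸ L)), (y, y + d) ∈ U := by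
    refine isCompact_univ.eventually_forall_of_forall_eventually fun y _ => ?_
    have hc : Continuous fun z : ((G × H) ⧸ L) × ((G × H) ⧸ L) => (z.2, z.2 + z.1) := by fun_prop
    refine hc.continuousAt.eventually (hU _ ?_)
    simp
  have h2 : Tendsto (fun y : (G × H) ⧸ L => y - x) (𝓝 x) (𝓝 0) := by
    have : Continuous fun y : (G × H) ⧸ L => y - x := by fun_prop
    simpa using this.tendsto x
  filter_upwards [h2.eventually h1] with y hy g
  have := hy (torusAct L g x) (mem_univ _)
  rwa [torusAct, add_assoc, add_sub_cancel] at this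

theorem exists_isCompact_image_mk_eq_univ [CompactSpace ((G × H) ⧸ L)] :
    ∃ F : Set (G × H), IsCompact F ∧ ∀ x : (G × H) ⧸ L, ∃ t ∈ F, (t : (G × H) ⧸ L) = x := by
  choose K hK hKm using fun t : G × H => exists_compact_mem_nhds t
  obtain ⟨s, hs⟩ := isCompact_univ.elim_finite_subcover
    (fun t : G × H => ((↑) : G × H → (G × H) ⧸ L) '' interior (K t))
    (fun t => QuotientAddGroup.isOpenMap_coe _ isOpen_interior) fun x _ => by
      obtain ⟨t, rfl⟩ := QuotientAddGroup.mk_surjective x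
      exact mem_iUnion.2 ⟨t, t, mem_interior_iff_mem_nhds.2 (hKm t), rfl⟩
  refine ⟨⋃ t ∈ s, K t, s.isCompact_biUnion fun t _ => hK t, fun x => ?_⟩
  obtain ⟨t, ht, y, hy, rfl⟩ := mem_iUnion₂.1 (hs (mem_univ x))
  exact ⟨y, mem_iUnion₂.2 ⟨t, ht, interior_subset hy⟩, rfl⟩

/-- The points `x` of the torus such that `x + L` has no point over the boundary of `W`. -/
def regularPoints (W : Set H) : Set ((G × H) ⧸ L) :=
  {x | ∀ t : G × H, (t : (G × H) ⧸ L) = x → t.2 ∉ frontier W}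

theorem isGδ_regularPoints [DiscreteTopology L] {W : Set H} (hW : IsCompact W) :
    IsGδ (regularPoints L W) := by
  have : IsClosed (L : Set (G × H)) := AddSubgroup.isClosed_of_discrete
  have hF : IsCompact (frontier W) := hW.of_isClosed_subset isClosed_frontier
    (frontier_subset_closure.trans hW.isClosed.closure_eq.subset)
  have h : regularPoints L W = ⋂ n, (((↑) : G × H → (G × H) ⧸ L) ''
      (compactCovering G n ×ˢ frontier W))ᶜ := by
    ext x
    simp only [regularPoints, mem_ofPred_eq, mem_iInter, mem_compl_iff]
    constructor
    · rintro h n ⟨t, ht, htx⟩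
      exact h t htx ht.2
    · intro h t htx ht
      obtain ⟨n, hn⟩ := exists_mem_compactCovering t.1
      exact h n ⟨t, ⟨hn, ht⟩, htx⟩
  rw [h]
  exact IsGδ.iInter_of_isOpen fun n => (((isCompact_compactCovering G n).prod hF).image
    QuotientAddGroup.continuous_mk).isClosed.isOpen_compl

theorem dense_regularPoints [DiscreteTopology L] {W : Set H} (hW : IsClosed W) :
    Dense (regularPoints L W) := by
  have : Countable L := TopologicalSpace.separableSpace_iff_countable.1 inferInstance
  have h1 : Dense (⋂ ℓ : L, {t : G × H | (t + (ℓ : G × H)).2 ∈ (frontier W)ᶜ}) := by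
    refine dense_iInter_of_isOpen (fun ℓ => ?_) fun ℓ => ?_
    · exact isClosed_frontier.isOpen_compl.preimage (by fun_prop)
    · have h2 : Dense (frontier W)ᶜ := interior_eq_empty_iff_dense_compl.1 (interior_frontier hW)
      exact h2.preimage (isOpenMap_snd.comp (Homeomorph.addRight (ℓ : G × H)).isOpenMap)
  refine (QuotientAddGroup.mk_surjective.denseRange.dense_image
    QuotientAddGroup.continuous_mk h1).mono ?_
  rintro _ ⟨t, ht, rfl⟩ s hs
  have := mem_iInter.1 ht ⟨-t + s, QuotientAddGroup.eq.1 hs.symm⟩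
  simpa using this

/-! ### The point sets of the extended hull -/

variable {L} {W : Set H}

theorem nonempty_patchSet (hL : Dense (Prod.snd '' (L : Set (G × H)))) (hW : (interior W).Nonempty)
    {p : (G × H) × (L → Bool)} (hp : p ∈ admissible L W) : (patchSet L p).Nonempty := by
  obtain ⟨w, hw⟩ := hW
  obtain ⟨_, ⟨ℓ, hℓ, rfl⟩, hℓW⟩ := hL.exists_mem_open
    (isOpen_interior.preimage (continuous_const_add p.1.2)) ⟨-p.1.2 + w, by simpa using hw⟩
  exact ⟨_, ⟨ℓ, hℓ⟩, (hp ⟨ℓ, hℓ⟩).1 hℓW, rfl⟩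

theorem mk_eq_of_patchSet_eq (hL : Dense (Prod.snd '' (L : Set (G × H))))
    (hW : (interior W).Nonempty) {p q : (G × H) × (L → Bool)} (hp : p ∈ admissible L W)
    (h : patchSet L p = patchSet L q) : (p.1 : (G × H) ⧸ L) = q.1 := by
  obtain ⟨y, hy⟩ := nonempty_patchSet hL hW hp
  rw [← mk_eq_of_mem_patchSet hy, mk_eq_of_mem_patchSet (h ▸ hy)]

/-- If the projection to `G` of one point set of the hull is contained in the projection of
another one, then the lattice points of the first are, up to a shift, among those of the second,
because lattice points are determined by their first coordinates. -/
theorem apply_sub_add_of_image_fst_subset (hL : InjOn Prod.fst (L : Set (G × H)))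
    {p q : (G × H) × (L → Bool)} (h : Prod.fst '' patchSet L p ⊆ Prod.fst '' patchSet L q)
    {k m : L} (hkm : (q.1 + (m : G × H)).1 = (p.1 + (k : G × H)).1) {ℓ : L} (hℓ : p.2 ℓ = true) :
    q.2 (ℓ - k + m) = true := by
  obtain ⟨_, ⟨n, hn, rfl⟩, he⟩ := h ⟨_, ⟨ℓ, hℓ, rfl⟩, rfl⟩
  have : ℓ - k + m = n := by
    refine Subtype.ext (hL (ℓ - k + m).2 n.2 ?_)
    simp only [Prod.fst_add, AddSubgroup.coe_add, AddSubgroup.coe_sub, Prod.fst_sub] at he hkm ⊢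
    have h1 := congrArg₂ (· - ·) he hkm
    simp only [add_sub_add_left_eq_sub] at h1
    rw [← h1, sub_add_cancel]
  rwa [this]

/-- A shift that maps the lattice points of one point set of the hull to those of another one
moves the interior of the window into itself, since the projection of `L` to `H` is dense. -/
theorem add_mem_interior_of_forall_apply (hL : Dense (Prod.snd '' (L : Set (G × H))))
    (hW : IsClosed W) {p q : (G × H) × (L → Bool)} (hp : p ∈ admissible L W)
    (hq : q ∈ admissible L W) {k m : L} (h : ∀ ℓ, p.2 ℓ = true → q.2 (ℓ - k + m) = true) {w : H}
    (hw : w ∈ interior W) :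
    (q.1 + (m : G × H)).2 - (p.1 + (k : G × H)).2 + w ∈ interior W := by
  set d := (q.1 + (m : G × H)).2 - (p.1 + (k : G × H)).2 with hd
  have hS : Dense ((fun a => p.1.2 + a) '' (Prod.snd '' (L : Set (G × H)))) :=
    (Homeomorph.addLeft p.1.2).surjective.denseRange.dense_image
      (Homeomorph.addLeft p.1.2).continuous hL
  have h1 : interior W ⊆ (fun w => d + w) ⁻¹' W := by
    refine (hS.open_subset_closure_inter isOpen_interior).trans
      (closure_minimal ?_ (hW.preimage (continuous_const_add d)))
    rintro _ ⟨hi, _, ⟨ℓ, hℓ, rfl⟩, rfl⟩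
    have h2 := (hq _).2 (h ⟨ℓ, hℓ⟩ ((hp ⟨ℓ, hℓ⟩).1 hi))
    have h3 : (q.1 + ((⟨ℓ, hℓ⟩ - k + m : L) : G × H)).2 = d + (p.1.2 + ℓ.2) := by
      simp only [hd, Prod.snd_add, AddSubgroup.coe_add, AddSubgroup.coe_sub, Prod.snd_sub]
      abel
    rwa [h3] at h2
  have h4 : (fun a => d + a) '' interior W ⊆ interior W :=
    interior_maximal (image_subset_iff.2 h1)
      ((Homeomorph.addLeft d).isOpenMap _ isOpen_interior)
  exact h4 ⟨w, hw, rfl⟩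

/-- Point sets of the hull are determined by their projections to `G`: if two of them have the
same projection, the difference of their `H`-coordinates is a period of the interior of `W`. -/
theorem patchSet_eq_of_image_fst_eq (hLi : InjOn Prod.fst (L : Set (G × H)))
    (hL : Dense (Prod.snd '' (L : Set (G × H)))) (hWc : IsClosed W)
    (hWne : (interior W).Nonempty) (hWa : IsAperiodic (interior W))
    {p q : (G × H) × (L → Bool)} (hp : p ∈ admissible L W) (hq : q ∈ admissible L W)
    (h : Prod.fst '' patchSet L p = Prod.fst '' patchSet L q) :
    patchSet L p = patchSet L q := by
  obtain ⟨_, k, hk, rfl⟩ := nonempty_patchSet hL hWne hp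
  obtain ⟨_, ⟨m, hm, rfl⟩, hkm⟩ := h.subset ⟨_, ⟨k, hk, rfl⟩, rfl⟩
  have h1 : ∀ ℓ, p.2 ℓ = true → q.2 (ℓ - k + m) = true := fun ℓ hℓ =>
    apply_sub_add_of_image_fst_subset hLi h.subset hkm hℓ
  have h2 : ∀ ℓ, q.2 ℓ = true → p.2 (ℓ - m + k) = true := fun ℓ hℓ =>
    apply_sub_add_of_image_fst_subset hLi h.symm.subset hkm.symm hℓ
  have hd := hWa ((q.1 + (m : G × H)).2 - (p.1 + (k : G × H)).2) <| by
    refine Subset.antisymm ?_ fun w hw => ?_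
    · rintro _ ⟨w, hw, rfl⟩
      exact add_mem_interior_of_forall_apply hL hWc hp hq h1 hw
    · exact ⟨_, add_mem_interior_of_forall_apply hL hWc hq hp h2 hw, by
        dsimp only
        rw [← add_assoc, sub_add_sub_cancel, sub_self, zero_add]⟩
  have hpq : q.1 + (m : G × H) = p.1 + (k : G × H) := Prod.ext hkm (sub_eq_zero.1 hd)
  refine Subset.antisymm ?_ ?_
  · rintro _ ⟨ℓ, hℓ, rfl⟩
    refine ⟨_, h1 ℓ hℓ, ?_⟩
    simp only [AddSubgroup.coe_add, AddSubgroup.coe_sub]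
    rw [add_comm _ (m : G × H), ← add_assoc, hpq, add_assoc, add_sub_cancel]
  · rintro _ ⟨ℓ, hℓ, rfl⟩
    refine ⟨_, h2 ℓ hℓ, ?_⟩
    simp only [AddSubgroup.coe_add, AddSubgroup.coe_sub]
    rw [add_comm _ (k : G × H), ← add_assoc, ← hpq, add_assoc, add_sub_cancel]

end Torus

section ExtendedHull

variable {G : Type u} [AddCommGroup G] [TopologicalSpace G] [IsTopologicalAddGroup G]
  [T2Space G] [LocallyCompactSpace G] [SecondCountableTopology G]
  [MeasurableSpace G] [BorelSpace G]
variable {H : Type v} [AddCommGroup H] [TopologicalSpace H] [IsTopologicalAddGroup H]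
  [T2Space H] [LocallyCompactSpace H] [SecondCountableTopology H]
  [MeasurableSpace H] [BorelSpace H]
variable (L : AddSubgroup (G × H)) [DiscreteTopology L] [CompactSpace ((G × H) ⧸ L)]
  (W : TopologicalSpace.Compacts H)

/-! ### The dynamics of the extended hull -/

/-- The extended hull is the image of a compact set of admissible parameters: the closure of the
parameters of the configurations `ν_W(t + L)`, where `t` runs through a compact set meeting all
cosets of `L`. -/
theorem exists_isCompact_image_patch_eq_MW :
    ∃ K : Set ((G × H) × (L → Bool)), IsCompact K ∧ K ⊆ admissible L (W : Set H) ∧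
      patch L '' K = MW L W := by
  obtain ⟨F, hF, hFs⟩ := exists_isCompact_image_mk_eq_univ L
  have hK : IsCompact (closure (windowParam L (W : Set H) '' F)) := by
    refine (hF.prod isCompact_univ).closure_of_subset (K := F ×ˢ (univ : Set (L → Bool))) ?_
    rintro _ ⟨t, ht, rfl⟩
    exact ⟨ht, mem_univ _⟩
  have himg : patch L '' (windowParam L (W : Set H) '' F) = range (nuW L W) := by
    ext ν
    constructor
    · rintro ⟨_, ⟨t, -, rfl⟩, rfl⟩
      exact ⟨_, (patch_windowParam W t).symm⟩
    · rintro ⟨x, rfl⟩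
      obtain ⟨t, ht, rfl⟩ := hFs x
      exact ⟨_, ⟨t, ht, rfl⟩, patch_windowParam W t⟩
  refine ⟨_, hK, closure_minimal ?_ (isClosed_admissible W.isCompact.isClosed), ?_⟩
  · rintro _ ⟨t, -, rfl⟩
    exact windowParam_mem_admissible _ t
  · rw [MW, ← himg]
    exact image_closure_of_isCompact hK continuous_patch.continuousOn

theorem exists_patch_eq (ν : MW L W) :
    ∃ p ∈ admissible L (W : Set H), patch L p = ν.1 := by
  obtain ⟨K, -, hKa, hKW⟩ := exists_isCompact_image_patch_eq_MW L W
  obtain ⟨p, hp, hpν⟩ := hKW.symm.subset ν.2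
  exact ⟨p, hKa hp, hpν⟩

theorem exists_compactSpace_surjective_patch :
    ∃ (K : Set ((G × H) × (L → Bool))) (k : K → MW L W), CompactSpace K ∧ Continuous k ∧
      Function.Surjective k ∧ ∀ p, (k p).1 = patch L p.1 := by
  obtain ⟨K, hK, -, hKW⟩ := exists_isCompact_image_patch_eq_MW L W
  refine ⟨K, fun p => ⟨patch L p.1, hKW.subset ⟨p.1, p.2, rfl⟩⟩, isCompact_iff_compactSpace.1 hK,
    (continuous_patch.comp continuous_subtype_val).subtype_mk _, fun ν => ?_, fun p => rfl⟩
  obtain ⟨p, hp, hpν⟩ := hKW.symm.subset ν.2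
  exact ⟨⟨p, hp⟩, Subtype.ext hpν⟩

instance compactSpace_MW : CompactSpace (MW L W) := by
  obtain ⟨K, hK, -, hKW⟩ := exists_isCompact_image_patch_eq_MW L W
  exact isCompact_iff_compactSpace.1 (hKW ▸ hK.image continuous_patch)

theorem isSystem_actMW : IsSystem (actMW L W) where
  compact := inferInstance
  t2 := inferInstance
  zero_act ν := by
    refine Subtype.ext (Subtype.ext ?_)
    change Measure.map (fun x => ((0, 0) : G × H) + x) ν.1.1 = ν.1.1
    have : (fun x : G × H => ((0, 0) : G × H) + x) = id := funext fun x => zero_add x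
    rw [this, Measure.map_id]
  add_act g g' ν := by
    refine Subtype.ext (Subtype.ext ?_)
    change Measure.map (fun x => ((g + g', 0) : G × H) + x) ν.1.1
      = Measure.map (fun x => ((g, 0) : G × H) + x)
        (Measure.map (fun x => ((g', 0) : G × H) + x) ν.1.1)
    rw [Measure.map_map (continuous_const_add _).measurable (continuous_const_add _).measurable]
    congr 1
    funext x
    ext <;> simp [add_assoc]
  continuous_act := by
    -- on the level of parameters the action is a translation, and `G × K → G × 𝓜_W` is a
    -- quotient map because `K` is compact
    obtain ⟨K, k, _, hk, hks, hkp⟩ := exists_compactSpace_surjective_patch L W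
    have hq : IsQuotientMap (Prod.map (id : G → G) k) :=
      (isProperMap_id.prodMap hk.isProperMap).isClosedMap.isQuotientMap
        (continuous_id.prodMap hk) (Function.surjective_id.prodMap hks)
    rw [hq.continuous_iff, continuous_induced_rng]
    have h : (Subtype.val ∘ (fun p : G × MW L W => actMW L W p.1 p.2) ∘ Prod.map id k)
        = fun p : G × K => patch L (((p.1, 0) : G × H) + p.2.1.1, p.2.1.2) :=
      by
      funext p
      refine Eq.trans ?_ (translate_patch _ _)
      rw [← hkp]
      rfl
    rw [h]
    exact continuous_patch.comp (by fun_prop)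

variable {L W}

theorem mk_eq_of_patch_eq (hL : Dense (Prod.snd '' (L : Set (G × H))))
    (hW : (interior (W : Set H)).Nonempty) {p q : (G × H) × (L → Bool)}
    (hp : p ∈ admissible L (W : Set H)) (h : patch L p = patch L q) :
    (p.1 : (G × H) ⧸ L) = q.1 :=
  mk_eq_of_patchSet_eq hL hW hp (configuration_injective (congrArg Subtype.val h))

variable (L W) in
/-- The map sending a configuration of the hull to the coset of `L` that contains its points, read
off from a chosen admissible parameter; by `cosetMap_eq` every parameter gives the same coset. -/
noncomputable def cosetMap (ν : MW L W) : (G × H) ⧸ L :=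
  ((exists_patch_eq L W ν).choose.1 : G × H)

theorem cosetMap_eq (hL : Dense (Prod.snd '' (L : Set (G × H))))
    (hW : (interior (W : Set H)).Nonempty) {ν : MW L W} {p : (G × H) × (L → Bool)}
    (h : patch L p = ν.1) : cosetMap L W ν = p.1 := by
  obtain ⟨h1, h2⟩ := (exists_patch_eq L W ν).choose_spec
  exact mk_eq_of_patch_eq hL hW h1 (h2.trans h.symm)

theorem cosetMap_of_eq_nuW (hL : Dense (Prod.snd '' (L : Set (G × H))))
    (hW : (interior (W : Set H)).Nonempty) {ν : MW L W} {x : (G × H) ⧸ L}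
    (h : ν.1 = nuW L W x) : cosetMap L W ν = x := by
  obtain ⟨t, rfl⟩ := QuotientAddGroup.mk_surjective x
  exact cosetMap_eq hL hW ((patch_windowParam W t).trans h.symm)

theorem isFactorMap_cosetMap (hL : Dense (Prod.snd '' (L : Set (G × H))))
    (hW : (interior (W : Set H)).Nonempty) :
    IsFactorMap (actMW L W) (torusAct L) (cosetMap L W) where
  source := isSystem_actMW L W
  target := isSystem_torusAct L
  continuous := by
    obtain ⟨K, k, _, hk, hks, hkp⟩ := exists_compactSpace_surjective_patch L W
    rw [(hk.isClosedMap.isQuotientMap hk hks).continuous_iff]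
    have h : cosetMap L W ∘ k = fun p : K => (p.1.1 : (G × H) ⧸ L) :=
      funext fun p => cosetMap_eq hL hW (hkp p).symm
    rw [h]
    exact QuotientAddGroup.continuous_mk.comp continuous_subtype_val.fst
  surjective x := ⟨⟨nuW L W x, subset_closure ⟨x, rfl⟩⟩, cosetMap_of_eq_nuW hL hW rfl⟩
  equivariant g ν := by
    obtain ⟨p, hp, hpν⟩ := exists_patch_eq L W ν
    have h : patch L (((g, 0) : G × H) + p.1, p.2) = (actMW L W g ν).1 := by
      rw [← translate_patch, hpν]
      rfl
    rw [cosetMap_eq hL hW h, cosetMap_eq hL hW hpν, torusAct, QuotientAddGroup.mk_add]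

/-- The fibre over a coset without points over the boundary of `W` is a singleton: there, an
admissible set of lattice points is the set of all points over `W`. -/
theorem isAlmostOneToOneExtension_cosetMap (hL : Dense (Prod.snd '' (L : Set (G × H))))
    (hW : (interior (W : Set H)).Nonempty) :
    IsAlmostOneToOneExtension (actMW L W) (torusAct L) (cosetMap L W) := by
  refine ⟨isFactorMap_cosetMap hL hW, regularPoints L W, isGδ_regularPoints L W.isCompact,
    dense_regularPoints L W.isCompact.isClosed, fun x hx =>
    ⟨⟨nuW L W x, subset_closure ⟨x, rfl⟩⟩, cosetMap_of_eq_nuW hL hW rfl, fun ν hν => ?_⟩⟩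
  obtain ⟨p, hp, hpν⟩ := exists_patch_eq L W ν
  have hpx : (p.1 : (G × H) ⧸ L) = x := by rw [← hν, cosetMap_eq hL hW hpν]
  have hwin : p = windowParam L (W : Set H) p.1 := by
    refine Prod.ext rfl (funext fun ℓ => ?_)
    rw [Bool.eq_iff_iff]
    simp only [windowParam, decide_eq_true_eq]
    refine ⟨(hp ℓ).2, fun hℓ => (hp ℓ).1 ?_⟩
    by_contra hcon
    refine hx (p.1 + (ℓ : G × H)) ((QuotientAddGroup.mk_add_of_mem _ ℓ.2).trans hpx) ?_
    rw [W.isCompact.isClosed.frontier_eq]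
    exact ⟨hℓ, hcon⟩
  refine Subtype.ext ?_
  rw [← hpν, hwin, patch_windowParam, hpx]

/-! ### Projection of the extended hull to `G` -/

theorem ae_snd_mem_of_mem_MW (ν : MW L W) : ∀ᵐ x ∂ν.1.1, x.2 ∈ (W : Set H) := by
  obtain ⟨p, hp, hpν⟩ := exists_patch_eq L W ν
  have hm : MeasurableSet {x : G × H | x.2 ∈ (W : Set H)} :=
    measurable_snd W.isCompact.isClosed.measurableSet
  rw [ae_iff, ← hpν]
  refine (configuration_eq_zero_iff hm.compl).2 (disjoint_left.2 ?_)
  rintro _ ⟨ℓ, hℓ, rfl⟩ hn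
  exact hn ((hp ℓ).2 hℓ)

variable (L W) in
/-- The pushforward of configurations of the hull under the projection to `G`. It is locally finite
because these configurations live over the compact window. -/
noncomputable def pushFst (ν : MW L W) : LFMeasure G :=
  ⟨ν.1.1.map Prod.fst, ⟨fun y => by
    have := ν.1.2
    obtain ⟨K, hK, hy⟩ := exists_compact_mem_nhds y
    refine ⟨K, hy, ?_⟩
    rw [Measure.map_apply measurable_fst hK.measurableSet]
    refine lt_of_le_of_lt (measure_mono_ae ?_) (hK.prod W.isCompact).measure_lt_top
    filter_upwards [ae_snd_mem_of_mem_MW ν] with x hx hxK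
    exact ⟨hxK, hx⟩⟩⟩

theorem continuous_pushFst : Continuous (pushFst L W) := by
  refine continuous_vague_iff.2 fun f => ?_
  obtain ⟨χ, hχ, -, hχc, -⟩ :=
    exists_continuous_one_zero_of_isCompact W.isCompact isClosed_empty (disjoint_empty _)
  let f' : C_c(G × H, ℝ) :=
    { toFun := fun x => f x.1 * χ x.2
      continuous_toFun := by
        have := f.continuous
        fun_prop
      hasCompactSupport' := by
        refine HasCompactSupport.intro (f.hasCompactSupport.isCompact.prod hχc.isCompact)
          fun x hx => ?_
        by_cases h1 : x.1 ∈ tsupport f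
        · have h2 : x.2 ∉ tsupport χ := fun h => hx ⟨h1, h⟩
          simp [image_eq_zero_of_notMem_tsupport h2]
        · simp [image_eq_zero_of_notMem_tsupport h1] }
  have h : (fun ν : MW L W => ∫ x, f x ∂(pushFst L W ν).1) = fun ν => ∫ x, f' x ∂ν.1.1 := by
    funext ν
    refine (integral_map measurable_fst.aemeasurable
      f.continuous.aestronglyMeasurable).trans (integral_congr_ae ?_)
    filter_upwards [ae_snd_mem_of_mem_MW ν] with x hx
    change f x.1 = f x.1 * χ x.2
    rw [hχ hx, Pi.one_apply, mul_one]
  rw [h]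
  exact (continuous_integral_vague f').comp continuous_subtype_val

theorem pushFst_injective (hLi : InjOn Prod.fst (L : Set (G × H)))
    (hL : Dense (Prod.snd '' (L : Set (G × H)))) (hWne : (interior (W : Set H)).Nonempty)
    (hWa : IsAperiodic (interior (W : Set H))) : Function.Injective (pushFst L W) := by
  intro ν ν' h
  obtain ⟨p, hp, hpν⟩ := exists_patch_eq L W ν
  obtain ⟨q, hq, hqν⟩ := exists_patch_eq L W ν'
  have key : ∀ (μ : MW L W) (r : (G × H) × (L → Bool)), patch L r = μ.1 → ∀ a : G,
      a ∈ Prod.fst '' patchSet L r ↔ (pushFst L W μ).1 {a} ≠ 0 := by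
    intro μ r hr a
    have hs : MeasurableSet (Prod.fst ⁻¹' {a} : Set (G × H)) :=
      measurable_fst (measurableSet_singleton a)
    rw [pushFst, Measure.map_apply measurable_fst (measurableSet_singleton a), ← hr, Ne]
    change _ ↔ ¬ configuration (patchSet L r) _ = 0
    rw [configuration_eq_zero_iff hs, not_disjoint_iff]
    rfl
  have hset := patchSet_eq_of_image_fst_eq hLi hL W.isCompact.isClosed hWne hWa hp hq <| by
    ext a
    rw [key ν p hpν, key ν' q hqν, h]
  refine Subtype.ext ?_
  rw [← hpν, ← hqν]
  exact Subtype.ext (congrArg configuration hset)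

theorem pushFst_eq_nuWG {ν : MW L W} {x : (G × H) ⧸ L} (h : ν.1 = nuW L W x) :
    pushFst L W ν = nuWG L W x :=
  Subtype.ext (congrArg (fun μ : LFMeasure (G × H) => μ.1.map Prod.fst) h)

theorem range_pushFst : range (pushFst L W) = MWG L W := by
  refine Subset.antisymm ?_ (closure_minimal ?_ (isCompact_range continuous_pushFst).isClosed)
  · rintro _ ⟨ν, rfl⟩
    have hd : ν ∈ closure ((↑) ⁻¹' range (nuW L W) : Set (MW L W)) := by
      rw [closure_subtype, image_preimage_eq_inter_range, Subtype.range_coe,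
        (inter_eq_left (t := MW L W)).2 subset_closure]
      exact ν.2
    refine map_mem_closure continuous_pushFst hd ?_
    rintro μ ⟨x, hx⟩
    exact ⟨x, (pushFst_eq_nuWG hx.symm).symm⟩
  · rintro _ ⟨x, rfl⟩
    exact ⟨⟨nuW L W x, subset_closure ⟨x, rfl⟩⟩, pushFst_eq_nuWG rfl⟩

theorem pushFst_actMW (g : G) (ν : MW L W) :
    pushFst L W (actMW L W g ν) = translate g (pushFst L W ν) := by
  refine Subtype.ext ?_
  change (ν.1.1.map _).map Prod.fst = (ν.1.1.map Prod.fst).map _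
  rw [Measure.map_map (continuous_const_add g).measurable measurable_fst,
    Measure.map_map measurable_fst (continuous_const_add _).measurable]
  rfl

/-- The projection to `G` as a homeomorphism of the extended hulls. -/
noncomputable def pushFstHomeomorph (hLi : InjOn Prod.fst (L : Set (G × H)))
    (hL : Dense (Prod.snd '' (L : Set (G × H)))) (hWne : (interior (W : Set H)).Nonempty)
    (hWa : IsAperiodic (interior (W : Set H))) : MW L W ≃ₜ MWG L W :=
  (continuous_pushFst.isClosedEmbedding
    (pushFst_injective hLi hL hWne hWa)).isEmbedding.toHomeomorph.trans
      (Homeomorph.setCongr range_pushFst)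

end ExtendedHull

end ModelSet

theorem mainTheorem1
    {G : Type u} [AddCommGroup G] [TopologicalSpace G] [IsTopologicalAddGroup G]
    [T2Space G] [LocallyCompactSpace G] [SecondCountableTopology G]
    [MeasurableSpace G] [BorelSpace G]
    {H : Type v} [AddCommGroup H] [TopologicalSpace H] [IsTopologicalAddGroup H]
    [T2Space H] [LocallyCompactSpace H] [SecondCountableTopology H]
    [MeasurableSpace H] [BorelSpace H]
    (L : AddSubgroup (G × H)) [DiscreteTopology L] [CompactSpace ((G × H) ⧸ L)]
    (hL_inj : InjOn Prod.fst (L : Set (G × H)))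
    (hL_dense : Dense (Prod.snd '' (L : Set (G × H))))
    (W : TopologicalSpace.Compacts H)
    (hW_ne : (interior (W : Set H)).Nonempty)
    (hW : IsAperiodic (interior (W : Set H))) :
    ∃ (Φ : MW L W ≃ₜ MWG L W) (γ : MW L W → (G × H) ⧸ L) (Γ : MWG L W → (G × H) ⧸ L),
      -- the isomorphism induced by the projection to `G`
      (∀ ν : MW L W, (Φ ν).1.1 = ν.1.1.map Prod.fst) ∧
      (∀ (g : G) (ν : MW L W), Φ (actMW L W g ν) = actMWG L W g (Φ ν)) ∧
      -- the factor maps onto the torus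
      (∀ (x : (G × H) ⧸ L) (ν : MW L W), ν.1 = nuW L W x → γ ν = x) ∧
      (∀ ν : MW L W, Γ (Φ ν) = γ ν) ∧
      IsMaximalEquicontinuousFactor.{w} (actMW L W) (torusAct L) γ ∧
      IsAlmostOneToOneExtension (actMW L W) (torusAct L) γ ∧
      IsMaximalEquicontinuousFactor.{w} (actMWG L W) (torusAct L) Γ ∧
      IsAlmostOneToOneExtension (actMWG L W) (torusAct L) Γ ∧
      -- closed invariant subsets
      ∀ (M : Set (MWG L W)) (hM : ∀ g, MapsTo (actMWG L W g) M M), M.Nonempty → IsClosed M →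
        IsMaximalEquicontinuousFactor.{w} (restrictAct (actMWG L W) M hM) (torusAct L)
          (fun ν : M => Γ ν.1) ∧
        IsAlmostOneToOneExtension (restrictAct (actMWG L W) M hM) (torusAct L)
          (fun ν : M => Γ ν.1) := by
  let Φ := pushFstHomeomorph hL_inj hL_dense hW_ne hW
  have hΦ : ∀ (g : G) (ν : MW L W), Φ (actMW L W g ν) = actMWG L W g (Φ ν) := fun g ν =>
    Subtype.ext (pushFst_actMW g ν)
  have hmin := isMinimalAct_torusAct L hL_dense
  have heq := isEquicontinuous_torusAct L
  have hγ := isAlmostOneToOneExtension_cosetMap (L := L) (W := W) hL_dense hW_ne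
  have hΓ := hγ.of_homeomorph Φ hΦ
  refine ⟨Φ, cosetMap L W, cosetMap L W ∘ Φ.symm, fun ν => rfl, hΦ,
    fun x ν h => cosetMap_of_eq_nuW hL_dense hW_ne h, fun ν => by simp,
    hγ.isMaximalEquicontinuousFactor hmin heq, hγ, hΓ.isMaximalEquicontinuousFactor hmin heq, hΓ,
    fun M hM hne hc => ?_⟩
  have hM' := hΓ.restrictAct hmin hM hne hc
  exact ⟨hM'.isMaximalEquicontinuousFactor hmin heq, hM'⟩
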